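/- A transcendental entire function is an entire function $\mathbb C\to\mathbb C$ that is not a polynomial. A family $\mathcal F$ of entire functions is normal on a domain $U\subset\mathbb C$ if every sequence in $\mathcal F$ has a subsequence converging locally uniformly on $U$ to a finite function or to $\infty$; the Fatou set $F(\mathcal F)$ is the largest open subset of $\mathbb C$ on which $\mathcal F$ is normal, i.e. the union of all such domains. For an entire function $g$, $F(g)$ is the Fatou set of the family $\{g^m : m\ge 1\}$ of its iterates. Let $f_1,\dots,f_n$ be transcendental entire functions and let $G=\langle f_1,\dots,f_n\rangle$ be the semigroup they generate under composition. Suppose that $G$ is nearly abelian: there is a family $\Phi$ of affine maps $z\mapsto az+b$ ($a\neq0$), precompact in the topology of locally uniform convergence on $\mathbb C$, such that $\phi(F(G))=F(G)$ for every $\phi\in\Phi$, and for all $f,g\in G$ there is $\phi\in\Phi$ with $f\circ g=\phi\circ g\circ f$. Suppose further that $F(G)\neq\emptyset$ and that $\infty$ is not a limit function of $G$ on any component of $F(G)$: for no connected component $V$ of $F(G)$ is there a sequence in $G$ converging to $\infty$ locally uniformly on $V$. Then $F(G)=F(g)$ for every $g\in G$. -/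

import Mathlib

open Filter Topology

/-- `f` is a transcendental entire function: entire and not a polynomial. -/
def IsTranscendentalEntire (f : ℂ → ℂ) : Prop :=
  Differentiable ℂ f ∧ ¬ ∃ p : Polynomial ℂ, ∀ z, f z = p.eval z

/-- The semigroup generated by a set `S` of self-maps of `ℂ`, the operation being composition
(the multiplication of `Function.End ℂ`): all finite nonempty compositions of elements of `S`. -/
def generatedSemigroup (S : Set (ℂ → ℂ)) : Set (ℂ → ℂ) :=
  (Subsemigroup.closure (M := Function.End ℂ) S : Set (Function.End ℂ))

/-- The sequence `h` converges to `∞` uniformly on compact subsets of `U`. -/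
def TendstoInftyOn (h : ℕ → ℂ → ℂ) (U : Set ℂ) : Prop :=
  ∀ K ⊆ U, IsCompact K → ∀ R : ℝ, ∀ᶠ j in atTop, ∀ z ∈ K, R < ‖h j z‖

/-- Normality, in the sense of Montel, of a family `𝓕` of functions on a domain `U`: every
sequence in `𝓕` has a subsequence that converges locally uniformly on `U`, either to a finite
limit function or to `∞`. -/
def IsNormalOn (𝓕 : Set (ℂ → ℂ)) (U : Set ℂ) : Prop :=
  ∀ h : ℕ → ℂ → ℂ, (∀ j, h j ∈ 𝓕) → ∃ s : ℕ → ℕ, StrictMono s ∧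
    ((∃ η : ℂ → ℂ, TendstoLocallyUniformlyOn (fun j => h (s j)) η atTop U) ∨
      TendstoInftyOn (fun j => h (s j)) U)

/-- The Fatou set of a family of entire functions, the largest open set on which the family is
normal: the union of all domains of `ℂ` on which it is normal. -/
def fatouSet (𝓕 : Set (ℂ → ℂ)) : Set ℂ :=
  ⋃₀ {U : Set ℂ | IsOpen U ∧ IsConnected U ∧ IsNormalOn 𝓕 U}

/-- The family of iterates `g, g², g³, …` of `g`; the Fatou set `F(g)` is the Fatou set of
this family. -/
def iterates (g : ℂ → ℂ) : Set (ℂ → ℂ) :=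
  {h | ∃ m : ℕ, 1 ≤ m ∧ h = g^[m]}

/-- `V` is a connected component of the set `F`. -/
def IsComponentOf (V F : Set ℂ) : Prop :=
  ∃ z ∈ F, V = connectedComponentIn F z

/-- `∞` is a limit function of the family `𝓕` on `V`: some sequence of members of `𝓕` converges
to `∞` locally uniformly on `V`. -/
def InftyIsLimitFunctionOn (𝓕 : Set (ℂ → ℂ)) (V : Set ℂ) : Prop :=
  ∃ h : ℕ → ℂ → ℂ, (∀ j, h j ∈ 𝓕) ∧ TendstoInftyOn h V

/-- `φ` is an (invertible) affine map `z ↦ a z + b`, `a ≠ 0`. -/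
def IsAffineMap (φ : ℂ → ℂ) : Prop :=
  ∃ a b : ℂ, a ≠ 0 ∧ ∀ z, φ z = a * z + b

/-- A semigroup `G` of entire functions is nearly abelian: there is a family `Φ` of affine maps,
precompact for locally uniform convergence (the topology of `C(ℂ, ℂ)`), whose members map the
Fatou set of `G` onto itself, and such that any `f, g ∈ G` satisfy `f ∘ g = φ ∘ g ∘ f` for some
`φ ∈ Φ`. -/
def IsNearlyAbelian (G : Set (ℂ → ℂ)) : Prop :=
  ∃ Φ : Set C(ℂ, ℂ), (∀ φ ∈ Φ, IsAffineMap φ) ∧ IsCompact (closure Φ) ∧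
    (∀ φ ∈ Φ, φ '' fatouSet G = fatouSet G) ∧
    ∀ f ∈ G, ∀ g ∈ G, ∃ φ ∈ Φ, f ∘ g = φ ∘ g ∘ f

/-!
The inclusion `F(G) ⊆ F(g)` holds because the iterates of `g` belong to `G`. For the converse, near
commutativity enters only through `IsNearlyAbelian.exists_norm_comp_le`: precompactness of `Φ` gives
a constant `M` with `‖f (g x)‖ ≤ M (1 + ‖g (f x)‖)` for all `f, g ∈ G`.

Since `∞` is not a limit function on any component, `G` is locally bounded on `F(G)`
(`exists_norm_le_ball_of_mem_fatouSet`). If `h ∈ G` and `h u ∈ F(G)`, the maps `k ∘ h`, `k ∈ G`, are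
therefore uniformly bounded near `u`; hence so are the maps `h ∘ k`, so that all `k ∈ G` omit near
`u` the points where `h` is large, and `u ∈ F(G)` by Montel's theorem. Thus `F(G)` is backward
invariant (`mem_fatouSet_of_apply_mem`). On an open set disjoint from `F(G)` all members of `G` would
then omit the points of `F(G)`, so `F(G)` is dense by Montel's theorem (`dense_fatouSet`).

By density every domain on which the iterates of `g` are normal meets `F(G)`, so no sequence of
iterates tends to `∞` there, and the iterates are locally bounded on `F(g)`. The commutator estimate
now shows that every `f ∈ G` maps `F(g)` into itself (`apply_mem_fatouSet_iterates`). The complement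
of `F(g)` has at least two points (`exists_ne_notMem_fatouSet_iterates`), and these are omitted by
`G` on `F(g)`; a last application of Montel's theorem gives `F(g) ⊆ F(G)`.

Montel's theorem for families omitting two values (`isNormalOn_ball_of_omits`) is deduced from
Schottky's theorem, which is proved by way of a weak form of Bloch's theorem. Schottky's theorem also
yields `IsNonaffineEntire.exists_sphere_subset_image`: the image of a large disc of radius `r` under
an entire function that is not affine contains a circle of radius at least `2r` about the origin.
This shows that the members of `G` are not affine and that the complement of `F(g)` is not empty.
-/

/-! ### Bloch's theorem -/

open Metric in
/-- Under the bound `‖φ'‖ ≤ 2 ‖φ' p‖` the linear part dominates on the circle of radius `r / 6`, so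
the image of the disc contains a disc around `φ p`. -/
theorem ball_subset_image_of_norm_deriv_le {φ : ℂ → ℂ} {p : ℂ} {r : ℝ}
    (hφ : DifferentiableOn ℂ φ (ball p r)) (hr : 0 < r)
    (hb : ∀ z ∈ ball p r, ‖deriv φ z‖ ≤ 2 * ‖deriv φ p‖) :
    ball (φ p) (‖deriv φ p‖ * r / 24) ⊆ φ '' ball p r := by
  rcases eq_or_ne (deriv φ p) 0 with h0 | h0
  · simp [h0]
  have hd' : DifferentiableOn ℂ (deriv φ) (ball p r) := hφ.deriv isOpen_ball
  have hmaps : Set.MapsTo (deriv φ) (ball p r) (closedBall (deriv φ p) (3 * ‖deriv φ p‖)) := by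
    intro z hz
    rw [mem_closedBall, dist_eq_norm]
    linarith [norm_sub_le (deriv φ z) (deriv φ p), hb z hz]
  have hsub : closedBall p (r / 6) ⊆ ball p r := closedBall_subset_ball (by linarith)
  have hat : ∀ z ∈ closedBall p (r / 6), DifferentiableAt ℂ φ z := fun z hz =>
    hφ.differentiableAt (isOpen_ball.mem_nhds (hsub hz))
  have hψ : ∀ z ∈ closedBall p (r / 6),
      ‖deriv (fun w => φ w - deriv φ p * w) z‖ ≤ ‖deriv φ p‖ / 2 := by
    intro z hz
    have h1 := Complex.dist_le_div_mul_dist_of_mapsTo_ball hd' hmaps (hsub hz)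
    have h2 : deriv (fun w => φ w - deriv φ p * w) z = deriv φ z - deriv φ p := by
      have : HasDerivAt (fun w => φ w - deriv φ p * w) (deriv φ z - deriv φ p * 1) z :=
        (hat z hz).hasDerivAt.sub ((hasDerivAt_id z).const_mul (deriv φ p))
      simpa using this.deriv
    rw [h2, ← dist_eq_norm]
    refine h1.trans ?_
    have h3 : dist z p ≤ r / 6 := hz
    calc 3 * ‖deriv φ p‖ / r * dist z p ≤ 3 * ‖deriv φ p‖ / r * (r / 6) := by gcongr
      _ = ‖deriv φ p‖ / 2 := by field_simp; norm_num
  have hlow : ∀ z ∈ sphere p (r / 6), ‖deriv φ p‖ * r / 12 ≤ ‖φ z - φ p‖ := by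
    intro z hz
    have hz' := sphere_subset_closedBall hz
    have h1 := (convex_closedBall p (r / 6)).norm_image_sub_le_of_norm_deriv_le
      (f := fun w => φ w - deriv φ p * w) (fun w hw => (hat w hw).sub (by fun_prop)) hψ
      (mem_closedBall_self (by positivity)) hz'
    have h2 : ‖z - p‖ = r / 6 := by rw [← dist_eq_norm]; exact hz
    have h3 : φ z - φ p = deriv φ p * (z - p) +
      ((φ z - deriv φ p * z) - (φ p - deriv φ p * p)) := by ring
    have h4 := norm_sub_le_norm_add (deriv φ p * (z - p))
      ((φ z - deriv φ p * z) - (φ p - deriv φ p * p))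
    rw [← h3, norm_mul, h2] at h4
    rw [h2] at h1
    linarith
  have hdc : DiffContOnCl ℂ φ (ball p (r / 6)) :=
    DifferentiableOn.diffContOnCl (by
      rw [closure_ball _ (by positivity)]; exact hφ.mono hsub)
  have hfreq : ∃ᶠ z in 𝓝 p, φ z ≠ φ p := by
    intro h
    apply h0
    have : φ =ᶠ[𝓝 p] fun _ => φ p := h.mono fun z hz => not_not.1 hz
    rw [this.deriv_eq]; simp
  have := hdc.ball_subset_image_closedBall (by positivity) hlow hfreq
  refine subset_trans ?_ (this.trans (Set.image_mono hsub))
  apply ball_subset_ball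
  linarith

open Metric in
/-- A form of Bloch's theorem (with a non-optimal constant): maximizing `‖φ' z‖ (R/2 - ‖z - c‖)`
produces a disc in which the derivative is under control. -/
theorem bloch {φ : ℂ → ℂ} {c : ℂ} {R : ℝ}
    (hφ : DifferentiableOn ℂ φ (ball c R)) (hR : 0 < R) :
    ∃ w, ball w (‖deriv φ c‖ * R / 96) ⊆ φ '' ball c R := by
  rcases eq_or_ne (deriv φ c) 0 with h0 | h0
  · exact ⟨0, by simp [h0]⟩
  have hsub : closedBall c (R / 2) ⊆ ball c R := closedBall_subset_ball (by linarith)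
  have hd' : ContinuousOn (deriv φ) (closedBall c (R / 2)) :=
    ((hφ.deriv isOpen_ball).continuousOn).mono hsub
  obtain ⟨p, hp, hmax⟩ := (isCompact_closedBall c (R / 2)).exists_isMaxOn
    (f := fun z => ‖deriv φ z‖ * (R / 2 - dist z c))
    ⟨c, mem_closedBall_self (by positivity)⟩ (hd'.norm.mul (by fun_prop))
  have hmax' : ∀ z ∈ closedBall c (R / 2),
      ‖deriv φ z‖ * (R / 2 - dist z c) ≤ ‖deriv φ p‖ * (R / 2 - dist p c) := fun z hz => hmax hz
  have h1 := hmax' c (mem_closedBall_self (by positivity))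
  rw [dist_self, sub_zero] at h1
  have hpos : 0 < ‖deriv φ p‖ * (R / 2 - dist p c) := by
    have := norm_pos_iff.2 h0
    exact lt_of_lt_of_le (by positivity) h1
  have hs : 0 < R / 2 - dist p c := by
    by_contra h
    nlinarith [norm_nonneg (deriv φ p)]
  set s := R / 2 - dist p c with hsdef
  have hin : ∀ z ∈ ball p (s / 2), s / 2 ≤ R / 2 - dist z c := by
    intro z hz
    have : dist z p < s / 2 := hz
    linarith [dist_triangle z p c]
  have hball : ball p (s / 2) ⊆ ball c R := fun z hz => hsub (by
    rw [mem_closedBall]; linarith [hin z hz])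
  have := ball_subset_image_of_norm_deriv_le (hφ.mono hball) (half_pos hs) (by
    intro z hz
    have h2 := hin z hz
    have h3 := hmax' z (by rw [mem_closedBall]; linarith)
    have h4 : ‖deriv φ z‖ * (s / 2) ≤ ‖deriv φ p‖ * s :=
      le_trans (by gcongr) h3
    by_contra h5
    push Not at h5
    nlinarith)
  refine ⟨φ p, subset_trans (ball_subset_ball ?_) (this.trans (Set.image_mono hball))⟩
  linarith

/-! ### Schottky's theorem -/

open Metric in
theorem exists_holomorphic_log_of_ne_zero {u : ℂ → ℂ} {c : ℂ} {R : ℝ}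
    (hu : DifferentiableOn ℂ u (ball c R)) (h0 : ∀ z ∈ ball c R, u z ≠ 0) :
    ∃ l : ℂ → ℂ, DifferentiableOn ℂ l (ball c R) ∧ ∀ z ∈ ball c R, Complex.exp (l z) = u z := by
  rcases le_or_gt R 0 with hR | hR
  · exact ⟨0, by simp [ball_eq_empty.2 hR], by simp [ball_eq_empty.2 hR]⟩
  have hc : c ∈ ball c R := mem_ball_self hR
  obtain ⟨l, hlc, hl⟩ := (DifferentiableOn.isExactOn_ball (f := fun z => deriv u z / u z)
    ((hu.deriv isOpen_ball).div hu h0)).with_val_at c (Complex.log (u c))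
  have hld : DifferentiableOn ℂ l (ball c R) := fun z hz =>
    (hl z hz).differentiableAt.differentiableWithinAt
  refine ⟨l, hld, fun z hz => ?_⟩
  have hder : ∀ w ∈ ball c R, HasDerivAt (fun w => Complex.exp (l w) / u w) 0 w := by
    intro w hw
    have h1 := (hl w hw).cexp.div
      (hu.differentiableAt (isOpen_ball.mem_nhds hw)).hasDerivAt (h0 w hw)
    rwa [mul_assoc, div_mul_cancel₀ _ (h0 w hw), sub_self, zero_div] at h1
  have hconst := (convex_ball c R).is_const_of_fderivWithin_eq_zero (𝕜 := ℂ)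
    (fun w hw => (hder w hw).differentiableAt.differentiableWithinAt)
    (fun w hw => by
      rw [fderivWithin_of_isOpen isOpen_ball hw]
      ext
      simpa using (hder w hw).deriv) hz hc
  simp only [hlc, Complex.exp_log (h0 c hc), div_self (h0 c hc)] at hconst
  rwa [div_eq_one_iff_eq (h0 z hz)] at hconst

theorem abs_sinh_im_le_norm_cos (z : ℂ) : Real.sinh |z.im| ≤ ‖Complex.cos z‖ := by
  have h1 : ‖Complex.exp (z * Complex.I)‖ = Real.exp (-z.im) := by
    rw [Complex.norm_exp]; simp
  have h2 : ‖Complex.exp (-z * Complex.I)‖ = Real.exp (z.im) := by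
    rw [Complex.norm_exp]; simp
  rw [Complex.cos, norm_div, Complex.norm_ofNat]
  have h3 := norm_sub_le_norm_add (Complex.exp (z * Complex.I)) (Complex.exp (-z * Complex.I))
  have h4 := norm_sub_le_norm_add (Complex.exp (-z * Complex.I)) (Complex.exp (z * Complex.I))
  rw [add_comm (Complex.exp (-z * Complex.I))] at h4
  rw [h1, h2] at h3 h4
  rw [Real.sinh_eq]
  rcases abs_cases z.im with ⟨h, -⟩ | ⟨h, -⟩ <;> rw [h] <;>
    (try rw [neg_neg]) <;> linarith

theorem norm_cos_le_exp_norm (z : ℂ) : ‖Complex.cos z‖ ≤ Real.exp ‖z‖ := by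
  have h1 : ‖Complex.exp (z * Complex.I)‖ ≤ Real.exp ‖z‖ := by
    simpa using Complex.norm_exp_le_exp_norm (z * Complex.I)
  have h2 : ‖Complex.exp (-z * Complex.I)‖ ≤ Real.exp ‖z‖ := by
    simpa using Complex.norm_exp_le_exp_norm (-z * Complex.I)
  rw [Complex.cos, norm_div, Complex.norm_ofNat]
  linarith [norm_add_le (Complex.exp (z * Complex.I)) (Complex.exp (-z * Complex.I))]

open Metric in
/-- Since `u² - 1` has no zeros, `u` lifts through the cosine; subtracting an even integer
normalizes the value of the lift at the centre. -/
theorem exists_cos_pi_mul_eq {u : ℂ → ℂ} (hu : DifferentiableOn ℂ u (ball 0 1))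
    (h1 : ∀ z ∈ ball (0 : ℂ) 1, u z ≠ 1) (h2 : ∀ z ∈ ball (0 : ℂ) 1, u z ≠ -1) :
    ∃ h : ℂ → ℂ, DifferentiableOn ℂ h (ball 0 1) ∧
      (∀ z ∈ ball (0 : ℂ) 1, Complex.cos (Real.pi * h z) = u z) ∧ ‖h 0‖ ≤ 1 + ‖u 0‖ := by
  have hne : ∀ z ∈ ball (0 : ℂ) 1, u z ^ 2 - 1 ≠ 0 := by
    intro z hz h
    rcases mul_self_eq_one_iff.1 (by linear_combination h : u z * u z = 1) with h | h
    · exact h1 z hz h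
    · exact h2 z hz h
  obtain ⟨l, hl, hlu⟩ := exists_holomorphic_log_of_ne_zero
    (u := fun z => u z ^ 2 - 1) ((hu.pow 2).sub_const 1) hne
  set v : ℂ → ℂ := fun z => Complex.exp (l z / 2) with hv
  have hv2 : ∀ z ∈ ball (0 : ℂ) 1, v z ^ 2 = u z ^ 2 - 1 := by
    intro z hz
    rw [← hlu z hz, hv, ← Complex.exp_nat_mul]
    congr 1
    push_cast
    ring
  have hvd : DifferentiableOn ℂ v (ball 0 1) := (hl.div_const 2).cexp
  have hprod : ∀ z ∈ ball (0 : ℂ) 1, (u z + v z) * (u z - v z) = 1 := by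
    intro z hz
    linear_combination -hv2 z hz
  obtain ⟨k, hk, hku⟩ := exists_holomorphic_log_of_ne_zero (hu.add hvd) (fun z hz h => by
    have := hprod z hz
    rw [show u z + v z = 0 from h] at this
    simp at this)
  have hpi : (Real.pi : ℂ) ≠ 0 := by exact_mod_cast Real.pi_ne_zero
  set h : ℂ → ℂ := fun z => k z / (Real.pi * Complex.I) with hh
  have hcos : ∀ z ∈ ball (0 : ℂ) 1, Complex.cos (Real.pi * h z) = u z := by
    intro z hz
    have e1 : Real.pi * h z * Complex.I = k z := by
      simp only [hh]
      field_simp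
    have e2 := hku z hz
    have e3 : Complex.exp (-(k z)) = u z - v z := by
      rw [Complex.exp_neg, e2]
      exact inv_eq_of_mul_eq_one_right (hprod z hz)
    rw [Complex.cos, neg_mul, e1, e2, e3]
    simp only [Pi.add_apply]
    ring
  set m : ℤ := round ((h 0).re / 2)
  have hre : |(h 0 - 2 * m).re| ≤ 1 := by
    have := abs_sub_round ((h 0).re / 2)
    have e : (h 0 - 2 * m).re = 2 * ((h 0).re / 2 - m) := by simp; ring
    rw [e, abs_mul, abs_two]
    linarith
  have hcos' : ∀ z ∈ ball (0 : ℂ) 1, Complex.cos (Real.pi * (h z - 2 * m)) = u z := by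
    intro z hz
    rw [← hcos z hz, show Real.pi * (h z - 2 * m) = Real.pi * h z - m * (2 * Real.pi) by ring,
      Complex.cos_sub_int_mul_two_pi]
  refine ⟨fun z => h z - 2 * m, (hk.div_const _).sub_const _, hcos', ?_⟩
  have him : |(h 0 - 2 * m).im| ≤ ‖u 0‖ := by
    have e := abs_sinh_im_le_norm_cos (Real.pi * (h 0 - 2 * m))
    rw [hcos' 0 (by simp)] at e
    refine le_trans ?_ (le_trans (Real.self_le_sinh_iff.2 (abs_nonneg _)) e)
    rw [Complex.im_ofReal_mul, abs_mul, abs_of_pos Real.pi_pos]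
    exact le_mul_of_one_le_left (abs_nonneg _) (by linarith [Real.pi_gt_three])
  exact (Complex.norm_le_abs_re_add_abs_im _).trans (add_le_add hre him)

/-- The points `n + i x` with `cosh (π x)` an integer are so dense that every disc of radius `1`
contains one of them; there `cos (π ·)` takes integer values. -/
theorem exists_mem_ball_cos_pi_mul_eq_intCast (w : ℂ) :
    ∃ a ∈ Metric.ball w 1, ∃ k : ℤ, Complex.cos (Real.pi * a) = k := by
  have hpi := Real.pi_gt_three
  set X := Real.pi * |w.im| with hX
  have hX0 : 0 ≤ X := by positivity
  set m : ℤ := ⌊Real.cosh X⌋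
  have hm1 : (1 : ℝ) ≤ m := by
    exact_mod_cast Int.le_floor.2 (by exact_mod_cast Real.one_le_cosh X)
  have hm2 : (m : ℝ) ≤ Real.cosh X := Int.floor_le _
  have hm3 : Real.cosh X < m + 1 := Int.lt_floor_add_one _
  obtain ⟨x, ⟨hx0, hxX⟩, hx⟩ := intermediate_value_Icc hX0 Real.continuous_cosh.continuousOn
    (show (m : ℝ) ∈ Set.Icc (Real.cosh 0) (Real.cosh X) by simp [hm1, hm2])
  -- `x ≥ 0` by choice; if `x < X - 2`, then `cosh X ≥ cosh 2 * cosh x ≥ 2 m ≥ m + 1`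
  have hlow : X - 2 ≤ x := by
    by_contra! hlt
    have e1 : Real.cosh X = Real.cosh (X - 2) * Real.cosh 2 + Real.sinh (X - 2) * Real.sinh 2 := by
      rw [← Real.cosh_add]; ring_nf
    have e2 : 0 ≤ Real.sinh (X - 2) * Real.sinh 2 :=
      mul_nonneg (Real.sinh_nonneg_iff.2 (by linarith)) (Real.sinh_nonneg_iff.2 (by norm_num))
    have e3 : (m : ℝ) ≤ Real.cosh (X - 2) := by
      rw [← hx]
      exact Real.cosh_le_cosh.2 (abs_le_abs_of_nonneg hx0 hlt.le)
    have e4 : 2 ≤ Real.cosh 2 := by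
      rw [Real.cosh_eq]
      have : (2 + 1) ^ 2 / 2 ≤ Real.exp 2 := by
        have := Real.add_one_le_exp (1 : ℝ)
        have h' : Real.exp 2 = Real.exp 1 ^ 2 := by rw [← Real.exp_nat_mul]; norm_num
        rw [h']
        nlinarith [Real.exp_one_gt_d9]
      linarith [Real.exp_pos (-2)]
    nlinarith
  set n : ℤ := round w.re
  have hn : |w.re - n| ≤ 1 / 2 := abs_sub_round _
  -- `2 / 3` exceeds `2 / π`, and `(1 / 2) ^ 2 + (2 / 3) ^ 2 < 1`
  obtain ⟨y, hy, hyw⟩ : ∃ y : ℝ, |y| = x / Real.pi ∧ |y - w.im| ≤ 2 / 3 := by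
    have hd : |w.im| - x / Real.pi ≤ 2 / 3 ∧ x / Real.pi ≤ |w.im| := by
      have e : |w.im| = X / Real.pi := by rw [hX]; field_simp
      constructor
      · rw [e, ← sub_div, div_le_iff₀ Real.pi_pos]; linarith
      · rw [e]; gcongr
    have hxp : 0 ≤ x / Real.pi := by positivity
    rcases abs_cases w.im with ⟨h, -⟩ | ⟨h, -⟩
    · exact ⟨x / Real.pi, abs_of_nonneg hxp, by rw [abs_le]; constructor <;> linarith⟩
    · exact ⟨-(x / Real.pi), by rw [abs_neg, abs_of_nonneg hxp],
        by rw [abs_le]; constructor <;> linarith⟩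
  refine ⟨n + y * Complex.I, ?_, ?_⟩
  · rw [Metric.mem_ball, Complex.dist_eq_re_im, Real.sqrt_lt' one_pos]
    simp only [Complex.add_re, Complex.intCast_re, Complex.mul_re, Complex.ofReal_re,
      Complex.I_re, Complex.ofReal_im, Complex.I_im, Complex.add_im, Complex.intCast_im,
      Complex.mul_im]
    rw [abs_le] at hn hyw
    nlinarith
  · have hc : Complex.cosh (Real.pi * y) = m := by
      have : Real.cosh (Real.pi * y) = m := by
        rw [← Real.cosh_abs, abs_mul, abs_of_pos Real.pi_pos, hy, ← hx]
        congr 1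
        field_simp
      rw [← Complex.ofReal_mul, ← Complex.ofReal_cosh, this]
      simp
    have hs : Complex.sin (n * Real.pi) = 0 := Complex.sin_int_mul_pi n
    have hcos : Complex.cos (Real.pi * (n + y * Complex.I)) = Complex.cos (n * Real.pi) * m := by
      rw [show Real.pi * (n + y * Complex.I) = n * Real.pi + (Real.pi * y) * Complex.I by ring,
        Complex.cos_add, hs, Complex.cos_mul_I, hc]
      ring
    have hsq := Complex.sin_sq_add_cos_sq (n * Real.pi)
    rw [hs] at hsq
    rcases mul_self_eq_one_iff.1 (show Complex.cos (n * Real.pi) * Complex.cos (n * Real.pi) = 1 by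
      linear_combination hsq) with h | h
    · exact ⟨m, by rw [hcos, h, one_mul]⟩
    · exact ⟨-m, by rw [hcos, h]; push_cast; ring⟩

open Metric in
/-- **Schottky's theorem**. The function is written as `(1 + cos (π cos (π g))) / 2` with `g 0`
bounded; the image of `g` contains no disc of radius `1`, so Bloch's theorem bounds `g'`. -/
theorem schottky (B : ℝ) : ∃ C : ℝ, ∀ F : ℂ → ℂ, DifferentiableOn ℂ F (ball 0 1) →
    (∀ z ∈ ball (0 : ℂ) 1, F z ≠ 0) → (∀ z ∈ ball (0 : ℂ) 1, F z ≠ 1) → ‖F 0‖ ≤ B →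
    ∀ z ∈ closedBall (0 : ℂ) (1 / 2), ‖F z‖ ≤ C := by
  refine ⟨1 + Real.exp (Real.pi * Real.exp (Real.pi * (3 + 2 * B + 96))), ?_⟩
  intro F hF h0 h1 hB z hz
  obtain ⟨h, hh, hcos, hhb⟩ := exists_cos_pi_mul_eq (u := fun z => 2 * F z - 1)
    ((hF.const_mul 2).sub_const 1)
    (fun z hz e => h1 z hz (by linear_combination e / 2))
    (fun z hz e => h0 z hz (by linear_combination e / 2))
  have hint : ∀ z ∈ ball (0 : ℂ) 1, ∀ k : ℤ, h z ≠ k := by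
    intro z hz k e
    have e1 := hcos z hz
    have e2 : Complex.sin (Real.pi * h z) = 0 := by
      rw [e, mul_comm]; exact Complex.sin_int_mul_pi k
    have e3 := Complex.sin_sq_add_cos_sq (Real.pi * h z)
    rw [e1, e2] at e3
    have e4 : F z * (F z - 1) = 0 := by linear_combination e3 / 4
    rcases mul_eq_zero.1 e4 with e5 | e5
    · exact h0 z hz e5
    · exact h1 z hz (sub_eq_zero.1 e5)
  obtain ⟨g, hg, hgcos, hgb⟩ := exists_cos_pi_mul_eq hh
    (fun z hz => by simpa using hint z hz 1) (fun z hz => by simpa using hint z hz (-1))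
  -- the image of `g` contains no disc of radius `1`, and `192 * (1 / 2) / 96 = 1` in Bloch's theorem
  have hderiv : ∀ w ∈ closedBall (0 : ℂ) (1 / 2), ‖deriv g w‖ ≤ 192 := by
    intro w hw
    have hsub : ball w (1 / 2) ⊆ ball 0 1 := by
      apply ball_subset_ball'
      have : dist w 0 ≤ 1 / 2 := hw
      linarith
    obtain ⟨c, hc⟩ := bloch (hg.mono hsub) (by norm_num)
    by_contra! hlt
    obtain ⟨a, ha, k, hk⟩ := exists_mem_ball_cos_pi_mul_eq_intCast c
    obtain ⟨x, hx, rfl⟩ := hc (ball_subset_ball (by linarith) ha)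
    exact hint x (hsub hx) k (by rw [← hgcos x (hsub hx), hk])
  have hgz : ‖g z‖ ≤ 3 + 2 * B + 96 := by
    have e1 := (convex_closedBall (0 : ℂ) (1 / 2)).norm_image_sub_le_of_norm_deriv_le
      (fun w hw => hg.differentiableAt (isOpen_ball.mem_nhds
        (closedBall_subset_ball (by norm_num) hw))) hderiv
      (mem_closedBall_self (by norm_num)) hz
    have e2 : ‖z - 0‖ ≤ 1 / 2 := by rw [← dist_eq_norm]; exact hz
    have e3 : ‖2 * F 0 - 1‖ ≤ 2 * B + 1 := by
      refine (norm_sub_le _ _).trans ?_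
      rw [norm_mul, Complex.norm_ofNat, norm_one]
      linarith
    have e4 : ‖g z‖ ≤ ‖g z - g 0‖ + ‖g 0‖ := by simpa using norm_add_le (g z - g 0) (g 0)
    linarith
  have hz1 : z ∈ ball (0 : ℂ) 1 := closedBall_subset_ball (by norm_num) hz
  have hhz : ‖h z‖ ≤ Real.exp (Real.pi * (3 + 2 * B + 96)) := by
    rw [← hgcos z hz1]
    refine (norm_cos_le_exp_norm _).trans (Real.exp_le_exp.2 ?_)
    rw [norm_mul, Complex.norm_real, Real.norm_of_nonneg Real.pi_pos.le]
    gcongr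
  have hu : ‖2 * F z - 1‖ ≤ Real.exp (Real.pi * Real.exp (Real.pi * (3 + 2 * B + 96))) := by
    rw [← hcos z hz1]
    refine (norm_cos_le_exp_norm _).trans (Real.exp_le_exp.2 ?_)
    rw [norm_mul, Complex.norm_real, Real.norm_of_nonneg Real.pi_pos.le]
    gcongr
  have e : ‖2 * F z‖ ≤ ‖2 * F z - 1‖ + 1 := by simpa using norm_add_le (2 * F z - 1) 1
  rw [norm_mul, Complex.norm_ofNat] at e
  linarith [norm_nonneg (F z)]

/-! ### Schottky's theorem on arbitrary discs, and the maximum principle -/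

open Metric in
/-- Schottky's theorem on an arbitrary disc and for an arbitrary pair of omitted values; the
constant depends on neither. -/
theorem schottky_ball (B : ℝ) : ∃ C : ℝ, ∀ (F : ℂ → ℂ) (c : ℂ) (R : ℝ) (a b : ℂ), 0 < R → a ≠ b →
    DifferentiableOn ℂ F (ball c R) → (∀ z ∈ ball c R, F z ≠ a) → (∀ z ∈ ball c R, F z ≠ b) →
    ‖F c - a‖ ≤ B * ‖b - a‖ → ∀ z ∈ closedBall c (R / 2), ‖F z - a‖ ≤ C * ‖b - a‖ := by
  obtain ⟨C, hC⟩ := schottky B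
  refine ⟨C, fun F c R a b hR hab hF ha hb hB z hz => ?_⟩
  have hba : b - a ≠ 0 := sub_ne_zero.2 hab.symm
  have hba' : 0 < ‖b - a‖ := norm_pos_iff.2 hba
  have hRc : (R : ℂ) ≠ 0 := by exact_mod_cast hR.ne'
  have hmem : ∀ w ∈ ball (0 : ℂ) 1, c + R * w ∈ ball c R := by
    intro w hw
    rw [mem_ball_zero_iff] at hw
    rw [mem_ball, dist_eq_norm, add_sub_cancel_left, norm_mul, Complex.norm_real,
      Real.norm_of_nonneg hR.le]
    nlinarith
  have key := hC (fun w => (F (c + R * w) - a) / (b - a))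
    (((hF.comp (by fun_prop) hmem).sub_const a).div_const _)
    (fun w hw e => ha _ (hmem w hw) (by
      rw [div_eq_zero_iff] at e
      exact sub_eq_zero.1 (e.resolve_right hba)))
    (fun w hw e => hb _ (hmem w hw) (by
      rw [div_eq_one_iff_eq hba] at e
      exact sub_left_injective e))
    (by simpa [norm_div, div_le_iff₀ hba'] using hB)
    ((z - c) / R) (by
      rw [mem_closedBall_zero_iff, norm_div, Complex.norm_real, Real.norm_of_nonneg hR.le,
        div_le_iff₀ hR, ← dist_eq_norm]
      have : dist z c ≤ R / 2 := hz
      linarith)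
  rw [norm_div, div_le_iff₀ hba', mul_div_cancel₀ _ hRc, add_sub_cancel] at key
  exact key

open Metric in
theorem norm_le_of_norm_le_on_sphere {f : ℂ → ℂ} (hf : Differentiable ℂ f) {c : ℂ} {r M : ℝ}
    (hr : 0 < r) (h : ∀ z ∈ sphere c r, ‖f z‖ ≤ M) : ∀ z ∈ closedBall c r, ‖f z‖ ≤ M := by
  intro z hz
  refine Complex.norm_le_of_forall_mem_frontier_norm_le (isBounded_ball (x := c) (r := r))
    hf.diffContOnCl ?_ (by rwa [closure_ball _ hr.ne'])
  rwa [frontier_ball _ hr.ne']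

/-! ### Montel's theorems -/

open Metric in
/-- Montel's theorem for uniformly bounded sequences, from Cauchy's estimate and Arzelà–Ascoli. -/
theorem exists_subseq_tendstoLocallyUniformlyOn_ball {h : ℕ → ℂ → ℂ} {c : ℂ} {R M : ℝ} (hR : 0 < R)
    (hd : ∀ j, DifferentiableOn ℂ (h j) (ball c R)) (hM : ∀ j, ∀ z ∈ ball c R, ‖h j z‖ ≤ M) :
    ∃ s : ℕ → ℕ, StrictMono s ∧
      ∃ η : ℂ → ℂ, TendstoLocallyUniformlyOn (fun j => h (s j)) η atTop (ball c (R / 2)) := by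
  set K := closedBall c (R / 2) with hK
  have hKR : K ⊆ ball c R := closedBall_subset_ball (by linarith)
  have hM0 : 0 ≤ M := (norm_nonneg _).trans (hM 0 c (mem_ball_self hR))
  have : CompactSpace K := isCompact_iff_compactSpace.1 (isCompact_closedBall _ _)
  have hder : ∀ j, ∀ z ∈ K, ‖deriv (h j) z‖ ≤ M / (R / 4) := by
    intro j z hz
    have hsub : closedBall z (R / 4) ⊆ ball c R := by
      intro w hw
      have h1 : dist w z ≤ R / 4 := hw
      have h2 : dist z c ≤ R / 2 := hz
      rw [mem_ball]
      linarith [dist_triangle w z c]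
    refine Complex.norm_deriv_le_of_forall_mem_sphere_norm_le (by positivity) ?_
      (fun w hw => hM j w (hsub (sphere_subset_closedBall hw)))
    exact DifferentiableOn.diffContOnCl (by
      rw [closure_ball _ (by positivity)]; exact (hd j).mono hsub)
  have hlip : ∀ j, ∀ x ∈ K, ∀ y ∈ K, dist (h j x) (h j y) ≤ M / (R / 4) * dist x y := by
    intro j x hx y hy
    rw [dist_eq_norm, dist_eq_norm]
    exact (convex_closedBall c (R / 2)).norm_image_sub_le_of_norm_deriv_le
      (fun w hw => (hd j).differentiableAt (isOpen_ball.mem_nhds (hKR hw))) (hder j) hy hx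
  let H : ℕ → BoundedContinuousFunction K ℂ := fun j =>
    BoundedContinuousFunction.mkOfCompact
      ⟨fun x => h j x, continuousOn_iff_continuous_domRestrict.1 ((hd j).continuousOn.mono hKR)⟩
  have hcomp := BoundedContinuousFunction.arzela_ascoli (closedBall (0 : ℂ) M)
    (isCompact_closedBall _ _) (Set.range H)
    (by
      rintro f x ⟨j, rfl⟩
      exact mem_closedBall_zero_iff.2 (hM j x (hKR x.2)))
    (by
      refine Metric.equicontinuous_of_continuity_modulus (fun t => M / (R / 4) * t) ?_ _ ?_
      · have : Tendsto (fun t : ℝ => M / (R / 4) * t) (𝓝 0) (𝓝 (M / (R / 4) * 0)) :=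
          (continuous_const.mul continuous_id).tendsto 0
        simpa using this
      · rintro x y ⟨_, j, rfl⟩
        exact hlip j x x.2 y y.2)
  obtain ⟨g, -, s, hs, hg⟩ := hcomp.tendsto_subseq (x := H) (fun j => subset_closure ⟨j, rfl⟩)
  rw [BoundedContinuousFunction.tendsto_iff_tendstoUniformly] at hg
  classical
  refine ⟨s, hs, fun z => if hz : z ∈ K then g ⟨z, hz⟩ else 0, ?_⟩
  refine TendstoLocallyUniformlyOn.mono (s := K) (TendstoUniformlyOn.tendstoLocallyUniformlyOn ?_)
    ball_subset_closedBall
  rw [tendstoUniformlyOn_iff_tendstoUniformly_comp_coe]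
  have hη : (fun z => if hz : z ∈ K then g ⟨z, hz⟩ else 0) ∘ ((↑) : K → ℂ) = g := by
    ext x
    simp
  rw [hη]
  exact hg

open Metric in
theorem isNormalOn_ball_of_norm_le {𝓕 : Set (ℂ → ℂ)} {c : ℂ} {R M : ℝ} (hR : 0 < R)
    (hd : ∀ f ∈ 𝓕, Differentiable ℂ f) (hM : ∀ f ∈ 𝓕, ∀ z ∈ ball c R, ‖f z‖ ≤ M) :
    IsNormalOn 𝓕 (ball c (R / 2)) := by
  intro h hh
  obtain ⟨s, hs, hη⟩ := exists_subseq_tendstoLocallyUniformlyOn_ball hR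
    (fun j => (hd _ (hh j)).differentiableOn) (fun j => hM _ (hh j))
  exact ⟨s, hs, Or.inl hη⟩

open Metric in
/-- Montel's theorem on families omitting two values. If the values at the centre are bounded along
a subsequence, Schottky's theorem bounds this subsequence; otherwise Schottky's theorem around the
other points of the disc shows that the sequence tends to infinity uniformly. -/
theorem isNormalOn_ball_of_omits {𝓕 : Set (ℂ → ℂ)} {c a b : ℂ} {R : ℝ} (hR : 0 < R)
    (hd : ∀ f ∈ 𝓕, Differentiable ℂ f) (hab : a ≠ b)
    (ha : ∀ f ∈ 𝓕, ∀ z ∈ ball c R, f z ≠ a) (hb : ∀ f ∈ 𝓕, ∀ z ∈ ball c R, f z ≠ b) :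
    IsNormalOn 𝓕 (ball c (R / 4)) := by
  intro h hh
  have hba' : 0 < ‖b - a‖ := norm_pos_iff.2 (sub_ne_zero.2 hab.symm)
  have hsch : ∀ B : ℝ, ∃ C : ℝ, ∀ j, ∀ x ∈ ball c (R / 2), ∀ y ∈ closedBall x (R / 4),
      ‖h j x‖ ≤ B → ‖h j y‖ ≤ C := by
    intro B
    obtain ⟨C, hC⟩ := schottky_ball ((B + ‖a‖) / ‖b - a‖)
    refine ⟨C * ‖b - a‖ + ‖a‖, fun j x hx y hy hB => ?_⟩
    have hsub : ball x (R / 2) ⊆ ball c R := by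
      apply ball_subset_ball'
      have : dist x c < R / 2 := hx
      linarith
    have := hC (h j) x (R / 2) a b (by positivity) hab (hd _ (hh j)).differentiableOn
      (fun z hz => ha _ (hh j) z (hsub hz)) (fun z hz => hb _ (hh j) z (hsub hz))
      (by
        rw [div_mul_cancel₀ _ hba'.ne']
        exact (norm_sub_le _ _).trans (by gcongr)) y
      (by rwa [show R / 2 / 2 = R / 4 by ring])
    have e : ‖h j y‖ ≤ ‖h j y - a‖ + ‖a‖ := by simpa using norm_add_le (h j y - a) a
    linarith
  by_cases hcase : ∃ B : ℝ, ∃ᶠ j in atTop, ‖h j c‖ ≤ B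
  · obtain ⟨B, hB⟩ := hcase
    obtain ⟨s, hs, hsB⟩ := extraction_of_frequently_atTop hB
    obtain ⟨C, hC⟩ := hsch B
    obtain ⟨C', hC'⟩ := hsch C
    -- every point of `ball c (R / 2)` is reached from `c` in two steps of length at most `R / 4`
    obtain ⟨t, ht, hη⟩ := exists_subseq_tendstoLocallyUniformlyOn_ball (h := fun j => h (s j))
      (c := c) (R := R / 2) (M := C') (by positivity) (fun j => (hd _ (hh _)).differentiableOn)
      (by
        intro j z hz
        have hz' : ‖z - c‖ < R / 2 := by rwa [← dist_eq_norm]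
        have hm : ‖(z - c) / 2‖ ≤ R / 4 := by
          rw [norm_div, Complex.norm_ofNat]
          linarith
        refine hC' (s j) (c + (z - c) / 2) ?_ z ?_
          (hC (s j) c (mem_ball_self (by positivity)) (c + (z - c) / 2) ?_ (hsB j))
        · rw [mem_ball, dist_eq_norm, add_sub_cancel_left]; linarith
        · rw [mem_closedBall, dist_eq_norm,
            show z - (c + (z - c) / 2) = (z - c) / 2 by ring]
          exact hm
        · rw [mem_closedBall, dist_eq_norm, add_sub_cancel_left]; exact hm)
    rw [show R / 2 / 2 = R / 4 by ring] at hη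
    exact ⟨s ∘ t, hs.comp ht, Or.inl hη⟩
  · push Not at hcase
    refine ⟨id, strictMono_id, Or.inr ?_⟩
    intro K hK _ r
    obtain ⟨C, hC⟩ := hsch r
    filter_upwards [hcase C] with j hj z hz
    by_contra! hle
    have hz' := hK hz
    refine absurd (hC j z (ball_subset_ball (by linarith) hz') c ?_ hle) (not_le.2 hj)
    rw [mem_closedBall, dist_comm]
    exact le_of_lt hz'

/-! ### Fatou sets -/

theorem mem_fatouSet_of_isNormalOn_ball {𝓕 : Set (ℂ → ℂ)} {c : ℂ} {r : ℝ} (hr : 0 < r)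
    (h : IsNormalOn 𝓕 (Metric.ball c r)) : c ∈ fatouSet 𝓕 :=
  Set.mem_sUnion.2 ⟨_, ⟨Metric.isOpen_ball, (convex_ball c r).isConnected
    ⟨c, Metric.mem_ball_self hr⟩, h⟩, Metric.mem_ball_self hr⟩

theorem isOpen_fatouSet (𝓕 : Set (ℂ → ℂ)) : IsOpen (fatouSet 𝓕) :=
  isOpen_sUnion fun _ h => h.1

theorem fatouSet_anti {𝓕 𝓖 : Set (ℂ → ℂ)} (h : 𝓕 ⊆ 𝓖) : fatouSet 𝓖 ⊆ fatouSet 𝓕 :=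
  Set.sUnion_subset_sUnion fun _ hU => ⟨hU.1, hU.2.1, fun k hk => hU.2.2 k fun j => h (hk j)⟩

/-! ### Entire functions that are not affine -/

/-- An entire function other than the polynomials of degree at most one. Unlike transcendence, this
property is easily seen to pass to compositions. -/
def IsNonaffineEntire (f : ℂ → ℂ) : Prop :=
  Differentiable ℂ f ∧ ¬ ∃ a b : ℂ, ∀ z, f z = a * z + b

theorem IsTranscendentalEntire.isNonaffineEntire {f : ℂ → ℂ} (hf : IsTranscendentalEntire f) :
    IsNonaffineEntire f := by
  refine ⟨hf.1, fun ⟨a, b, h⟩ => hf.2 ⟨Polynomial.C a * Polynomial.X + Polynomial.C b, ?_⟩⟩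
  intro z
  simp [h z]

open Metric in
theorem IsNonaffineEntire.not_linear_growth {f : ℂ → ℂ} (hf : IsNonaffineEntire f) (K : ℝ) :
    ∃ r₀ : ℝ, ∀ r ≥ r₀, ¬ ∀ z ∈ closedBall (0 : ℂ) r, ‖f z‖ ≤ K * r := by
  by_contra! hcon
  have hbd : ∀ w, ‖deriv f w‖ ≤ 2 * K := by
    intro w
    obtain ⟨r, hr, hb⟩ := hcon (2 * ‖w‖ + 1)
    have hr0 : 0 < r := by linarith [norm_nonneg w]
    have := Complex.norm_deriv_le_of_forall_mem_sphere_norm_le (c := w) (half_pos hr0)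
      hf.1.diffContOnCl (C := K * r) (fun z hz => hb z (by
        rw [mem_closedBall_zero_iff]
        have h1 : ‖z - w‖ = r / 2 := by rw [← dist_eq_norm]; exact hz
        have h2 : ‖z‖ ≤ ‖z - w‖ + ‖w‖ := by simpa using norm_add_le (z - w) w
        linarith))
    rwa [show K * r / (r / 2) = 2 * K by field_simp] at this
  have hf' : Differentiable ℂ (deriv f) := by
    rw [← differentiableOn_univ]
    exact hf.1.differentiableOn.deriv isOpen_univ
  have hconst := hf'.apply_eq_apply_of_bounded
    ((isBounded_iff_forall_norm_le).2 ⟨2 * K, by rintro _ ⟨w, rfl⟩; exact hbd w⟩)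
  have hder : ∀ z, HasDerivAt (fun z => f z - deriv f 0 * z) 0 z := by
    intro z
    have h : HasDerivAt (fun z => f z - deriv f 0 * z) (deriv f z - deriv f 0 * 1) z :=
      (hf.1 z).hasDerivAt.sub ((hasDerivAt_id z).const_mul (deriv f 0))
    rwa [mul_one, hconst z 0, sub_self] at h
  refine hf.2 ⟨deriv f 0, f 0, fun z => ?_⟩
  have := is_const_of_deriv_eq_zero (fun z => (hder z).differentiableAt)
    (fun z => (hder z).deriv) z 0
  linear_combination this

theorem IsNonaffineEntire.exists_lt_norm {f : ℂ → ℂ} (hf : IsNonaffineEntire f) (M : ℝ) :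
    ∃ z, M < ‖f z‖ := by
  by_contra! h
  have := hf.1.apply_eq_apply_of_bounded
    ((isBounded_iff_forall_norm_le).2 ⟨M, by rintro _ ⟨w, rfl⟩; exact h w⟩)
  exact hf.2 ⟨0, f 0, fun z => by rw [this z 0]; ring⟩

open Metric in
/-- If two values `a`, `b` on the circles of radii `2r` and `4r` were omitted on `ball 0 r` for
arbitrarily large `r`, Schottky's theorem would bound `f` linearly on `ball 0 (r / 2)`. -/
theorem IsNonaffineEntire.exists_sphere_subset_image {f : ℂ → ℂ} (hf : IsNonaffineEntire f) :
    ∃ r₀ : ℝ, ∀ r ≥ r₀, ∃ ρ ≥ 2 * r, sphere (0 : ℂ) ρ ⊆ f '' ball 0 r := by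
  obtain ⟨C, hC⟩ := schottky_ball (3 / 2)
  obtain ⟨r₀, hr₀⟩ := hf.not_linear_growth (2 * (6 * |C| + 2))
  refine ⟨max (2 * r₀) (‖f 0‖ + 1), fun r hr => ?_⟩
  have hr1 : r₀ ≤ r / 2 := by linarith [(le_max_left _ _).trans hr]
  have hr2 : ‖f 0‖ + 1 ≤ r := (le_max_right _ _).trans hr
  have hr0 : 0 < r := by linarith [norm_nonneg (f 0)]
  by_contra! hcon
  obtain ⟨a, ha, ha'⟩ := Set.not_subset.1 (hcon (2 * r) le_rfl)
  obtain ⟨b, hb, hb'⟩ := Set.not_subset.1 (hcon (4 * r) (by linarith))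
  rw [mem_sphere_zero_iff_norm] at ha hb
  have hba : 2 * r ≤ ‖b - a‖ := by linarith [norm_sub_norm_le b a]
  have hba2 : ‖b - a‖ ≤ 6 * r := by linarith [norm_sub_le b a]
  refine hr₀ (r / 2) hr1 fun z hz => ?_
  have h1 := hC f 0 r a b hr0 (by rintro rfl; linarith) hf.1.differentiableOn
    (fun z hz e => ha' ⟨z, hz, e⟩) (fun z hz e => hb' ⟨z, hz, e⟩)
    (by linarith [norm_sub_le (f 0) a]) z hz
  have h2 : C * ‖b - a‖ ≤ |C| * (6 * r) := by
    gcongr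
    exact le_abs_self C
  have h3 : ‖f z‖ ≤ ‖f z - a‖ + ‖a‖ := by simpa using norm_add_le (f z - a) a
  linarith

/-- The image under `h` of a disc contains a larger circle, on which `f` grows superlinearly. -/
theorem IsNonaffineEntire.comp {f h : ℂ → ℂ} (hf : IsNonaffineEntire f)
    (hh : IsNonaffineEntire h) : IsNonaffineEntire (f ∘ h) := by
  refine ⟨hf.1.comp hh.1, ?_⟩
  rintro ⟨a, b, hab⟩
  obtain ⟨r₀, hr₀⟩ := hh.exists_sphere_subset_image
  obtain ⟨r₁, hr₁⟩ := hf.not_linear_growth (‖a‖ + ‖b‖)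
  set r := max (max r₀ r₁) 1
  have h0 : r₀ ≤ r := (le_max_left _ _).trans (le_max_left _ _)
  have h1 : r₁ ≤ r := (le_max_right _ _).trans (le_max_left _ _)
  have h2 : 1 ≤ r := le_max_right _ _
  obtain ⟨ρ, hρ, hsub⟩ := hr₀ r h0
  refine hr₁ ρ (by linarith) (norm_le_of_norm_le_on_sphere hf.1 (by linarith) fun w hw => ?_)
  obtain ⟨z, hz, rfl⟩ := hsub hw
  rw [mem_ball_zero_iff] at hz
  have h3 : f (h z) = a * z + b := hab z
  rw [h3]
  refine (norm_add_le _ _).trans ?_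
  rw [norm_mul]
  nlinarith [norm_nonneg a, norm_nonneg b]

theorem isNonaffineEntire_of_mem_generatedSemigroup {S : Set (ℂ → ℂ)}
    (hS : ∀ f ∈ S, IsNonaffineEntire f) : ∀ g ∈ generatedSemigroup S, IsNonaffineEntire g := by
  intro g hg
  refine Subsemigroup.closure_induction (M := Function.End ℂ) (p := fun g _ => IsNonaffineEntire g)
    hS (fun x y _ _ hx hy => ?_) hg
  exact hx.comp hy

theorem comp_mem_generatedSemigroup {S : Set (ℂ → ℂ)} {f g : ℂ → ℂ}
    (hf : f ∈ generatedSemigroup S) (hg : g ∈ generatedSemigroup S) :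
    f ∘ g ∈ generatedSemigroup S :=
  (Subsemigroup.closure (M := Function.End ℂ) S).mul_mem hf hg

theorem iterates_subset_of_comp_mem {G : Set (ℂ → ℂ)}
    (hG : ∀ f ∈ G, ∀ g ∈ G, f ∘ g ∈ G) {g : ℂ → ℂ} (hg : g ∈ G) : iterates g ⊆ G := by
  rintro _ ⟨m, hm, rfl⟩
  induction m, hm using Nat.le_induction with
  | base => simpa using hg
  | succ m _ ih => rw [Function.iterate_succ]; exact hG _ ih _ hg

/-! ### Local boundedness on Fatou sets -/

open Metric in
/-- A family that is normal on `U` and has no sequence tending to infinity on `U` is locally bounded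
on `U`: a sequence with unbounded values near `z` would have no convergent subsequence. -/
theorem exists_norm_le_ball_of_isNormalOn {𝓕 : Set (ℂ → ℂ)} {U : Set ℂ} {z : ℂ}
    (hc : ∀ f ∈ 𝓕, Continuous f) (hU : IsOpen U) (hn : IsNormalOn 𝓕 U) (hz : z ∈ U)
    (hinf : ∀ h : ℕ → ℂ → ℂ, (∀ j, h j ∈ 𝓕) → ¬ TendstoInftyOn h U) :
    ∃ r > 0, ∃ M : ℝ, ∀ f ∈ 𝓕, ∀ w ∈ ball z r, ‖f w‖ ≤ M := by
  by_contra! hcon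
  choose k hk w hw hkw using fun j : ℕ => hcon (1 / ((j : ℝ) + 1)) (by positivity) j
  obtain ⟨s, hs, ⟨η, hη⟩ | hs'⟩ := hn k hk
  · have hwz : Tendsto w atTop (𝓝 z) := by
      rw [tendsto_iff_dist_tendsto_zero]
      exact squeeze_zero (fun _ => dist_nonneg) (fun j => le_of_lt (hw j))
        tendsto_one_div_add_atTop_nhds_zero_nat
    have hηc : ContinuousOn η U :=
      hη.continuousOn (Frequently.of_forall fun j => (hc _ (hk _)).continuousOn)
    have hlim := hη.tendsto_comp (hηc z hz) hz
      (tendsto_nhdsWithin_of_tendsto_nhds_of_eventually_within w hwz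
        (hwz.eventually_mem (hU.mem_nhds hz)) |>.comp hs.tendsto_atTop)
    refine not_tendsto_nhds_of_tendsto_atTop ?_ _ hlim.norm
    refine tendsto_atTop_mono (fun j => (hkw (s j)).le) ?_
    exact tendsto_natCast_atTop_atTop.comp hs.tendsto_atTop
  · exact hinf _ (fun j => hk (s j)) hs'

/-- If a sequence tends to infinity near one point of a Fatou component, then it does so on the
whole component: the set of points near which it tends to infinity is open, and by normality it is
relatively closed. -/
theorem tendstoInftyOn_connectedComponentIn {𝓕 : Set (ℂ → ℂ)} {U : Set ℂ} {z : ℂ} {h : ℕ → ℂ → ℂ}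
    (hh : ∀ j, h j ∈ 𝓕) (hU : IsOpen U) (hzU : z ∈ U) (hinf : TendstoInftyOn h U)
    (hz : z ∈ fatouSet 𝓕) : TendstoInftyOn h (connectedComponentIn (fatouSet 𝓕) z) := by
  set A : Set ℂ := {w | ∃ t ∈ 𝓝 w, ∀ R : ℝ, ∀ᶠ j in atTop, ∀ x ∈ t, R < ‖h j x‖} with hA
  have hAopen : IsOpen A := by
    rw [isOpen_iff_mem_nhds]
    rintro w ⟨t, ht, htR⟩
    filter_upwards [eventually_mem_nhds_iff.2 ht] with w' hw'
    exact ⟨t, hw', htR⟩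
  have hzA : z ∈ A := by
    obtain ⟨ε, hε, hsub⟩ := Metric.nhds_basis_closedBall.mem_iff.1 (hU.mem_nhds hzU)
    exact ⟨_, Metric.closedBall_mem_nhds z hε, hinf _ hsub (isCompact_closedBall z ε)⟩
  have hVA : connectedComponentIn (fatouSet 𝓕) z ⊆ A := by
    refine isPreconnected_connectedComponentIn.subset_of_closure_inter_subset hAopen
      ⟨z, mem_connectedComponentIn hz, hzA⟩ ?_
    rintro w ⟨hwA, hwV⟩
    obtain ⟨W, ⟨hW, -, hWn⟩, hwW⟩ := Set.mem_sUnion.1 (connectedComponentIn_subset _ _ hwV)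
    obtain ⟨a, haW, t, ht, htR⟩ := mem_closure_iff.1 hwA W hW hwW
    obtain ⟨ε, hε, hsub⟩ := Metric.nhds_basis_closedBall.mem_iff.1 (hW.mem_nhds hwW)
    refine ⟨_, Metric.closedBall_mem_nhds w hε, fun R => ?_⟩
    by_contra hcon
    obtain ⟨s, hs, hsR⟩ := extraction_of_frequently_atTop (not_eventually.1 hcon)
    obtain ⟨s', hs', ⟨η, hη⟩ | hη⟩ := hWn (fun j => h (s j)) (fun j => hh _)
    · refine not_tendsto_nhds_of_tendsto_atTop ?_ _ (hη.tendsto_at haW).norm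
      refine tendsto_atTop.2 fun R' => ?_
      filter_upwards [(hs.comp hs').tendsto_atTop.eventually (htR R')] with j hj
      exact (hj a (mem_of_mem_nhds ht)).le
    · obtain ⟨j, hj⟩ := (hη _ hsub (isCompact_closedBall w ε) R).exists
      exact hsR (s' j) hj
  intro K hK hKc R
  refine hKc.induction_on (p := fun S => ∀ᶠ j in atTop, ∀ x ∈ S, R < ‖h j x‖) (by simp)
    (fun S T hST hT => hT.mono fun j hj x hx => hj x (hST hx))
    (fun S T hS hT => ?_) fun x hx => ?_
  · filter_upwards [hS, hT] with j hj hj' x hx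
    exact hx.elim (hj x) (hj' x)
  · obtain ⟨t, ht, htR⟩ := hVA (hK hx)
    exact ⟨t, mem_nhdsWithin_of_mem_nhds ht, htR R⟩

open Metric in
theorem exists_norm_le_ball_of_mem_fatouSet {G : Set (ℂ → ℂ)} (hc : ∀ f ∈ G, Continuous f)
    (hinf : ∀ V : Set ℂ, IsComponentOf V (fatouSet G) → ¬ InftyIsLimitFunctionOn G V)
    {z : ℂ} (hz : z ∈ fatouSet G) :
    ∃ r > 0, ∃ M : ℝ, ∀ f ∈ G, ∀ w ∈ ball z r, ‖f w‖ ≤ M := by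
  obtain ⟨U, ⟨hU, -, hUn⟩, hzU⟩ := Set.mem_sUnion.1 hz
  refine exists_norm_le_ball_of_isNormalOn hc hU hUn hzU fun h hh hi => ?_
  exact hinf _ ⟨z, hz, rfl⟩ ⟨h, hh, tendstoInftyOn_connectedComponentIn hh hU hzU hi hz⟩

theorem IsCompact.exists_norm_le_of_locally {𝓕 : Set (ℂ → ℂ)} {K : Set ℂ} (hK : IsCompact K)
    (h : ∀ z ∈ K, ∃ r > 0, ∃ M : ℝ, ∀ f ∈ 𝓕, ∀ w ∈ Metric.ball z r, ‖f w‖ ≤ M) :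
    ∃ M : ℝ, ∀ f ∈ 𝓕, ∀ w ∈ K, ‖f w‖ ≤ M := by
  refine hK.induction_on (p := fun S => ∃ M : ℝ, ∀ f ∈ 𝓕, ∀ w ∈ S, ‖f w‖ ≤ M) ⟨0, by simp⟩
    (fun S T hST ⟨M, hM⟩ => ⟨M, fun f hf w hw => hM f hf w (hST hw)⟩)
    (fun S T ⟨M, hM⟩ ⟨N, hN⟩ => ⟨max M N, fun f hf w hw => ?_⟩) fun z hz => ?_
  · exact hw.elim (fun hw => (hM f hf w hw).trans (le_max_left _ _))
      (fun hw => (hN f hf w hw).trans (le_max_right _ _))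
  · obtain ⟨r, hr, M, hM⟩ := h z hz
    exact ⟨_, mem_nhdsWithin_of_mem_nhds (Metric.ball_mem_nhds z hr), M, hM⟩

/-! ### Backward invariance and density of the Fatou set of a nearly abelian semigroup -/

/-- The only consequence of near-commutativity that the argument uses: by precompactness the maps
in `Φ` grow at most linearly, uniformly in `Φ`. -/
theorem IsNearlyAbelian.exists_norm_comp_le {G : Set (ℂ → ℂ)} (hG : IsNearlyAbelian G) :
    ∃ M : ℝ, 0 ≤ M ∧ ∀ f ∈ G, ∀ g ∈ G, ∀ x, ‖f (g x)‖ ≤ M * (1 + ‖g (f x)‖) := by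
  obtain ⟨Φ, haff, hΦ, -, hcomm⟩ := hG
  have hev : ∀ w : ℂ, ∃ C : ℝ, ∀ φ ∈ closure Φ, ‖φ w‖ ≤ C := fun w =>
    hΦ.exists_bound_of_continuousOn (f := fun φ : C(ℂ, ℂ) => φ w)
      (continuous_eval_const w).continuousOn
  obtain ⟨C₀, hC₀⟩ := hev 0
  obtain ⟨C₁, hC₁⟩ := hev 1
  refine ⟨|C₀| + |C₁|, by positivity, fun f hf g hg x => ?_⟩
  obtain ⟨φ, hφ, he⟩ := hcomm f hf g hg
  obtain ⟨a, b, -, hab⟩ := haff φ hφ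
  have h0 := (hC₀ φ (subset_closure hφ)).trans (le_abs_self _)
  have h1 := (hC₁ φ (subset_closure hφ)).trans (le_abs_self _)
  rw [hab] at h0 h1
  rw [mul_zero, zero_add] at h0
  rw [mul_one] at h1
  have ha : ‖a‖ ≤ |C₀| + |C₁| := by
    have : ‖a‖ ≤ ‖a + b‖ + ‖b‖ := by simpa using norm_sub_le (a + b) b
    linarith
  have hfg : f (g x) = a * g (f x) + b := by
    have := congrFun he x
    simpa [hab] using this
  rw [hfg]
  refine (norm_add_le _ _).trans ?_
  rw [norm_mul]
  nlinarith [norm_nonneg (g (f x)), norm_nonneg b, abs_nonneg C₁]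

open Metric in
/-- A family whose members map some neighbourhood of `z` into the complement of a set with two
points is normal near `z`. -/
theorem mem_fatouSet_of_omits {G : Set (ℂ → ℂ)} (hd : ∀ f ∈ G, Differentiable ℂ f) {z a b : ℂ}
    {U : Set ℂ} (hU : U ∈ 𝓝 z) (hab : a ≠ b) (ha : ∀ f ∈ G, ∀ x ∈ U, f x ≠ a)
    (hb : ∀ f ∈ G, ∀ x ∈ U, f x ≠ b) : z ∈ fatouSet G := by
  obtain ⟨R, hR, hsub⟩ := Metric.mem_nhds_iff.1 hU
  exact mem_fatouSet_of_isNormalOn_ball (by positivity)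
    (isNormalOn_ball_of_omits hR hd hab (fun f hf x hx => ha f hf x (hsub hx))
      (fun f hf x hx => hb f hf x (hsub hx)))

open Metric in
/-- Backward invariance of the Fatou set. Near `u` the maps `k ∘ h` are uniformly bounded, hence so
are the maps `h ∘ k`; therefore all `k ∈ G` omit the points at which `h` is large. -/
theorem mem_fatouSet_of_apply_mem {G : Set (ℂ → ℂ)} {M : ℝ} (hM : 0 ≤ M)
    (hent : ∀ f ∈ G, IsNonaffineEntire f)
    (hcomm : ∀ f ∈ G, ∀ g ∈ G, ∀ x, ‖f (g x)‖ ≤ M * (1 + ‖g (f x)‖))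
    (hbd : ∀ z ∈ fatouSet G, ∃ r > 0, ∃ M : ℝ, ∀ f ∈ G, ∀ w ∈ ball z r, ‖f w‖ ≤ M)
    {h : ℂ → ℂ} (hh : h ∈ G) {u : ℂ} (hu : h u ∈ fatouSet G) : u ∈ fatouSet G := by
  obtain ⟨r, hr, N, hN⟩ := hbd _ hu
  obtain ⟨δ, hδ, hsub⟩ := Metric.mem_nhds_iff.1
    ((hent h hh).1.continuous.continuousAt.preimage_mem_nhds (ball_mem_nhds _ hr))
  obtain ⟨a, ha⟩ := (hent h hh).exists_lt_norm (M * (1 + N))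
  obtain ⟨b, hb⟩ := (hent h hh).exists_lt_norm ‖h a‖
  have homit : ∀ c, M * (1 + N) < ‖h c‖ → ∀ k ∈ G, ∀ x ∈ ball u δ, k x ≠ c := by
    rintro c hc k hk x hx rfl
    refine absurd (hcomm h hh k hk x) (not_le.2 (lt_of_le_of_lt ?_ hc))
    gcongr
    exact hN k hk _ (hsub hx)
  exact mem_fatouSet_of_omits (fun f hf => (hent f hf).1) (ball_mem_nhds u hδ)
    (by rintro rfl; exact hb.false) (homit a ha) (homit b (ha.trans hb))

open Metric in
/-- A nonempty backward invariant Fatou set is dense: on an open set disjoint from it, all members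
of the family would omit its points. -/
theorem dense_fatouSet {G : Set (ℂ → ℂ)} (hd : ∀ f ∈ G, Differentiable ℂ f)
    (hne : (fatouSet G).Nonempty)
    (hback : ∀ h ∈ G, ∀ u, h u ∈ fatouSet G → u ∈ fatouSet G) : Dense (fatouSet G) := by
  intro z
  rw [_root_.mem_closure_iff]
  intro U hU hzU
  by_contra hcon
  have hdis : ∀ f ∈ G, ∀ x ∈ U, f x ∉ fatouSet G := fun f hf x hx hfx =>
    hcon ⟨x, hx, hback f hf x hfx⟩
  obtain ⟨p, hp⟩ := hne
  obtain ⟨q, hq, hqp⟩ :=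
    (Set.Infinite.nontrivial
      (infinite_of_mem_nhds p ((isOpen_fatouSet G).mem_nhds hp))).exists_ne p
  refine hcon ⟨z, hzU, mem_fatouSet_of_omits hd (hU.mem_nhds hzU) hqp
    (fun f hf x hx e => hdis f hf x hx (e ▸ hq)) (fun f hf x hx e => hdis f hf x hx (e ▸ hp))⟩

/-! ### The complement of the Fatou set of the iterates -/

/-- By the maximum principle, a bound for all iterates on a large disc extends to the larger disc
bounded by a circle in the image of the first one. Repeating this would bound `g` on the plane. -/
theorem IsNonaffineEntire.not_forall_iterates_bounded {g : ℂ → ℂ} (hg : IsNonaffineEntire g) :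
    ¬ ∀ r : ℝ, ∃ M : ℝ, ∀ k ∈ iterates g, ∀ z ∈ Metric.closedBall (0 : ℂ) r, ‖k z‖ ≤ M := by
  intro hb
  obtain ⟨r₀, hr₀⟩ := hg.exists_sphere_subset_image
  set r₁ := max r₀ 1
  obtain ⟨S, hS⟩ := hb r₁
  have hdiff : ∀ k ∈ iterates g, Differentiable ℂ k := by
    rintro _ ⟨m, -, rfl⟩
    exact hg.1.iterate m
  have key : ∀ n : ℕ, ∃ r ≥ r₁, (n : ℝ) ≤ r ∧
      ∀ k ∈ iterates g, ∀ z ∈ Metric.closedBall (0 : ℂ) r, ‖k z‖ ≤ S := by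
    intro n
    induction n with
    | zero => exact ⟨r₁, le_rfl, by
        rw [Nat.cast_zero]; exact zero_le_one.trans (le_max_right r₀ 1), hS⟩
    | succ n ih =>
      obtain ⟨r, hr, hnr, hbr⟩ := ih
      have h1 : 1 ≤ r := (le_max_right r₀ 1).trans hr
      obtain ⟨ρ, hρ, hsub⟩ := hr₀ r ((le_max_left r₀ 1).trans hr)
      refine ⟨ρ, by linarith, by push_cast; linarith, fun k hk => ?_⟩
      refine norm_le_of_norm_le_on_sphere (hdiff k hk) (by linarith) fun w hw => ?_
      obtain ⟨z, hz, rfl⟩ := hsub hw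
      obtain ⟨m, hm, rfl⟩ := hk
      rw [← Function.iterate_succ_apply]
      exact hbr _ ⟨m + 1, by omega, rfl⟩ z (Metric.ball_subset_closedBall hz)
  obtain ⟨z, hz⟩ := hg.exists_lt_norm S
  obtain ⟨n, hn⟩ := exists_nat_ge ‖z‖
  obtain ⟨r, -, hnr, hbr⟩ := key n
  exact absurd (hbr g ⟨1, le_rfl, rfl⟩ z (mem_closedBall_zero_iff.2 (hn.trans hnr))) (not_le.2 hz)

open Metric in
/-- An isolated point of the complement would be removable by the maximum principle, and an empty
complement is excluded by `IsNonaffineEntire.not_forall_iterates_bounded`. -/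
theorem exists_ne_notMem_fatouSet_iterates {g : ℂ → ℂ} (hg : IsNonaffineEntire g)
    (hbd : ∀ z ∈ fatouSet (iterates g),
      ∃ r > 0, ∃ M : ℝ, ∀ f ∈ iterates g, ∀ w ∈ ball z r, ‖f w‖ ≤ M) :
    ∃ a b, a ≠ b ∧ a ∉ fatouSet (iterates g) ∧ b ∉ fatouSet (iterates g) := by
  by_contra! hcon
  have hdiff : ∀ k ∈ iterates g, Differentiable ℂ k := by
    rintro _ ⟨m, -, rfl⟩
    exact hg.1.iterate m
  have huniv : ∀ p, p ∈ fatouSet (iterates g) := by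
    intro p
    by_contra hp
    obtain ⟨M, hM⟩ := (isCompact_sphere p 1).exists_norm_le_of_locally (𝓕 := iterates g)
      (fun z hz => hbd z (hcon p z (by rintro rfl; simp at hz) hp))
    exact hp (mem_fatouSet_of_isNormalOn_ball (by positivity)
      (isNormalOn_ball_of_norm_le one_pos hdiff fun f hf z hz =>
        norm_le_of_norm_le_on_sphere (hdiff f hf) one_pos (hM f hf) z (ball_subset_closedBall hz)))
  exact hg.not_forall_iterates_bounded fun r =>
    (isCompact_closedBall 0 r).exists_norm_le_of_locally fun z _ => hbd z (huniv z)

/-! ### Forward invariance of the Fatou set of the iterates -/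

open Metric in
/-- If the iterates of `g` are bounded near `z`, so are the maps `f ∘ g^[m]` and hence the maps
`g^[m] ∘ f`; this bounds the iterates on a neighbourhood of `f z`. -/
theorem apply_mem_fatouSet_iterates {f g : ℂ → ℂ} {M r N : ℝ} (hM : 0 ≤ M)
    (hf : IsNonaffineEntire f) (hg : Differentiable ℂ g)
    (hcomm : ∀ k ∈ iterates g, ∀ x, ‖k (f x)‖ ≤ M * (1 + ‖f (k x)‖)) {z : ℂ} (hr : 0 < r)
    (hN : ∀ k ∈ iterates g, ∀ w ∈ ball z r, ‖k w‖ ≤ N) : f z ∈ fatouSet (iterates g) := by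
  obtain ⟨C, hC⟩ := (isCompact_closedBall (0 : ℂ) N).exists_bound_of_continuousOn
    hf.1.continuous.continuousOn
  have hopen : IsOpen (f '' ball z r) := by
    rcases (hf.1.differentiableOn.analyticOnNhd isOpen_univ).is_constant_or_isOpen
      isPreconnected_univ with ⟨w, hw⟩ | h
    · exact absurd ⟨0, w, fun x => by simp [hw x]⟩ hf.2
    · exact h _ (Set.subset_univ _) isOpen_ball
  obtain ⟨δ, hδ, hsub⟩ := Metric.isOpen_iff.1 hopen (f z) ⟨z, mem_ball_self hr, rfl⟩
  refine mem_fatouSet_of_isNormalOn_ball (by positivity)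
    (isNormalOn_ball_of_norm_le (M := M * (1 + C)) hδ ?_ fun k hk y hy => ?_)
  · rintro _ ⟨m, -, rfl⟩
    exact hg.iterate m
  · obtain ⟨x, hx, rfl⟩ := hsub hy
    refine (hcomm k hk x).trans ?_
    gcongr
    exact hC _ (mem_closedBall_zero_iff.2 (hN k hk x hx))

/-! ### The Fatou set of the semigroup and of its members -/

theorem mainTheorem1 (n : ℕ) (f : Fin n → ℂ → ℂ)
    (hf : ∀ i, IsTranscendentalEntire (f i))
    (G : Set (ℂ → ℂ)) (hG : G = generatedSemigroup (Set.range f))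
    (hab : IsNearlyAbelian G)
    (hne : (fatouSet G).Nonempty)
    (hinf : ∀ V : Set ℂ, IsComponentOf V (fatouSet G) → ¬ InftyIsLimitFunctionOn G V) :
    ∀ g ∈ G, fatouSet G = fatouSet (iterates g) := by
  intro g hg
  have hent : ∀ k ∈ G, IsNonaffineEntire k := by
    rw [hG]
    refine isNonaffineEntire_of_mem_generatedSemigroup ?_
    rintro _ ⟨i, rfl⟩
    exact (hf i).isNonaffineEntire
  have hdiff : ∀ k ∈ G, Differentiable ℂ k := fun k hk => (hent k hk).1
  have hit : iterates g ⊆ G := iterates_subset_of_comp_mem (by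
    rw [hG]; exact fun f hf g hg => comp_mem_generatedSemigroup hf hg) hg
  obtain ⟨M, hM, hcomm⟩ := hab.exists_norm_comp_le
  have hbd : ∀ z ∈ fatouSet G, ∃ r > 0, ∃ N : ℝ, ∀ k ∈ G, ∀ w ∈ Metric.ball z r, ‖k w‖ ≤ N :=
    fun z hz => exists_norm_le_ball_of_mem_fatouSet (fun k hk => (hdiff k hk).continuous) hinf hz
  have hdense : Dense (fatouSet G) := dense_fatouSet hdiff hne
    fun h hh u hu => mem_fatouSet_of_apply_mem hM hent hcomm hbd hh hu
  have hbd' : ∀ z ∈ fatouSet (iterates g),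
      ∃ r > 0, ∃ N : ℝ, ∀ k ∈ iterates g, ∀ w ∈ Metric.ball z r, ‖k w‖ ≤ N := by
    intro z hz
    obtain ⟨U, ⟨hU, -, hUn⟩, hzU⟩ := Set.mem_sUnion.1 hz
    refine exists_norm_le_ball_of_isNormalOn (fun k hk => (hdiff k (hit hk)).continuous) hU hUn hzU
      fun h hh hi => ?_
    -- `U` meets `fatouSet G`, where the members of `G` are locally bounded
    obtain ⟨p, hp, hpU⟩ := hdense.exists_mem_open hU ⟨z, hzU⟩
    obtain ⟨r, hr, N, hN⟩ := hbd p hp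
    obtain ⟨j, hj⟩ := (hi {p} (Set.singleton_subset_iff.2 hpU) isCompact_singleton N).exists
    exact absurd (hN _ (hit (hh j)) p (Metric.mem_ball_self hr)) (not_le.2 (hj p rfl))
  obtain ⟨a, b, hne_ab, ha, hb⟩ := exists_ne_notMem_fatouSet_iterates (hent g hg) hbd'
  have hinv : ∀ k ∈ G, ∀ x ∈ fatouSet (iterates g), k x ∈ fatouSet (iterates g) := by
    intro k hk x hx
    obtain ⟨r, hr, N, hN⟩ := hbd' x hx
    exact apply_mem_fatouSet_iterates hM (hent k hk) (hdiff g hg)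
      (fun h hh => hcomm h (hit hh) k hk) hr hN
  refine (fatouSet_anti hit).antisymm fun z hz => ?_
  exact mem_fatouSet_of_omits hdiff ((isOpen_fatouSet _).mem_nhds hz) hne_ab
    (fun k hk x hx e => ha (e ▸ hinv k hk x hx)) (fun k hk x hx e => hb (e ▸ hinv k hk x hx))
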